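/- Let $p, D\ge 0$, $M\ge 2$, $N\ge 1$ be integers and let $\rho:\mathbb R\to\mathbb R$ be nonnegative and $L_\rho$-Lipschitz. Let $\mathcal X\subseteq\mathbb R^{p}$ be an input space with $\|x\|_2\le C_1$ for all $x\in\mathcal X$, and let $\mathcal Q$ be a probability distribution of pairs $(x,y)\in\mathbb R^{p}\times\mathbb R^{D}$ such that almost surely $x\in\mathcal X$ and $|y_k|\le C_2$ for every $k=1,\dots,D$. Let $d_{min}\in\mathbb R$, and let $\mathcal F$ be the class of one-hidden-layer networks $f:\mathbb R^{p}\to\mathbb R^{D}$, $$f(x)_k=\sum_{m=1}^M v_{k,m}\,\phi_m(x),\qquad \phi_m(x)=\rho(w_m^Tx),$$ with $\|w_m\|_2\le C_3$ for all $m$, $|v_{k,m}|\le C_4$ for all $k,m$, and hidden features satisfying the diversity constraint $$\frac{1}{2M(M-1)}\sum_{n\ne m}\big(\phi_n(x)-\phi_m(x)\big)^2\ge d_{min}^2\qquad\text{for every }x\in\mathcal X,$$ where the sum is over ordered pairs $(n,m)$, $n\neq m$. For the squared loss put $$L(f)=\mathbb E_{(x,y)\sim\mathcal Q}\Big[\tfrac12\|f(x)-y\|_2^2\Big],\qquad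 \hat L(f)=\frac1N\sum_{i=1}^N\tfrac12\|f(x_i)-y_i\|_2^2,$$ where $(x_1,y_1),\dots,(x_N,y_N)$ are i.i.d. samples from $\mathcal Q$. Let $f^*\in\mathcal F$ be a minimizer of $L$ over $\mathcal F$. Then for every $\delta\in(0,1)$, with probability at least $1-\delta$ over the samples, every minimizer $\hat f\in\mathcal F$ of $\hat L$ over $\mathcal F$ satisfies $$L(\hat f)-L(f^*)\le(\sqrt{\mathcal J}+C_2)\frac{A}{\sqrt N}+\frac D2(\sqrt{\mathcal J}+C_2)^2\sqrt{\frac{2\log(2/\delta)}{N}},$$ where $$C_5=L_\rho C_1C_3+\rho(0),\quad \mathcal J=C_4^2\big(MC_5^2+M(M-1)(C_5^2-d_{min}^2)\big),\quad A=4D\big(2L_\rho C_1C_3C_4+C_4|\rho(0)|\big)M.$$ -/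

import Mathlib

open MeasureTheory

noncomputable section

/-- The `m`-th hidden feature `φ_m(x) = ρ(w_mᵀ x)` of a one-hidden-layer network with activation `ρ`
and hidden weight vectors `w_1, …, w_M`. -/
def hiddenFeature {p M : ℕ} (ρ : ℝ → ℝ) (W : Fin M → EuclideanSpace ℝ (Fin p)) (m : Fin M)
    (x : EuclideanSpace ℝ (Fin p)) : ℝ :=
  ρ (inner ℝ (W m) x)

/-- The diversity of the hidden features at the input `x`:
`1 / (2 M (M - 1)) * ∑_{n ≠ m} (φ_n(x) - φ_m(x))²`, the sum over ordered pairs. -/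
def featureDiversity {p M : ℕ} (ρ : ℝ → ℝ) (W : Fin M → EuclideanSpace ℝ (Fin p))
    (x : EuclideanSpace ℝ (Fin p)) : ℝ :=
  1 / (2 * (M : ℝ) * ((M : ℝ) - 1)) *
    ∑ n : Fin M, ∑ m : Fin M,
      if n ≠ m then (hiddenFeature ρ W n x - hiddenFeature ρ W m x) ^ 2 else 0

/-- The network with `D` outputs, `f(x)_k = ∑_m v_{k,m} φ_m(x)`. -/
def network {p M D : ℕ} (ρ : ℝ → ℝ) (W : Fin M → EuclideanSpace ℝ (Fin p))
    (V : Fin D → Fin M → ℝ) (x : EuclideanSpace ℝ (Fin p)) : EuclideanSpace ℝ (Fin D) :=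
  WithLp.toLp 2 (fun k => ∑ m, V k m * hiddenFeature ρ W m x)

/-- The hypothesis class: networks with `M` hidden units and `D` outputs, `‖w_m‖₂ ≤ C₃` for all `m`,
`‖v_k‖_∞ ≤ C₄` for every output `k`, whose hidden features have diversity at least `dmin ^ 2` at
every input of the input space `X`. -/
def hypothesisClass {p : ℕ} (M D : ℕ) (ρ : ℝ → ℝ) (X : Set (EuclideanSpace ℝ (Fin p)))
    (C₃ C₄ dmin : ℝ) : Set (EuclideanSpace ℝ (Fin p) → EuclideanSpace ℝ (Fin D)) :=
  {f | ∃ (W : Fin M → EuclideanSpace ℝ (Fin p)) (V : Fin D → Fin M → ℝ),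
    (∀ m, ‖W m‖ ≤ C₃) ∧ (∀ k m, |V k m| ≤ C₄) ∧
    (∀ x ∈ X, dmin ^ 2 ≤ featureDiversity ρ W x) ∧ f = network ρ W V}

/-- The squared loss `½ ‖u - y‖₂²`. -/
def squaredLoss {D : ℕ} (u y : EuclideanSpace ℝ (Fin D)) : ℝ :=
  1 / 2 * ‖u - y‖ ^ 2

/-- The expected risk `L(f) = 𝔼_{(x,y) ∼ Q} [½ ‖f(x) - y‖²]`. -/
def expectedRisk {p D : ℕ}
    (Q : Measure (EuclideanSpace ℝ (Fin p) × EuclideanSpace ℝ (Fin D)))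
    (f : EuclideanSpace ℝ (Fin p) → EuclideanSpace ℝ (Fin D)) : ℝ :=
  ∫ z, squaredLoss (f z.1) z.2 ∂Q

/-- The empirical risk `L̂(f) = (1/N) ∑_i ½ ‖f(x_i) - y_i‖²` on the sample `S`. -/
def empiricalRisk {p D N : ℕ}
    (S : Fin N → EuclideanSpace ℝ (Fin p) × EuclideanSpace ℝ (Fin D))
    (f : EuclideanSpace ℝ (Fin p) → EuclideanSpace ℝ (Fin D)) : ℝ :=
  1 / (N : ℝ) * ∑ i, squaredLoss (f (S i).1) (S i).2

/-- `f` minimizes `R` over the class `F`. -/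
def IsRiskMinimizer {α : Type*} (F : Set α) (R : α → ℝ) (f : α) : Prop :=
  f ∈ F ∧ ∀ g ∈ F, R f ≤ R g

/-- `C₅ = L_ρ C₁ C₃ + ρ(0)`. -/
def constC5 (ρ : ℝ → ℝ) (Lρ C₁ C₃ : ℝ) : ℝ := Lρ * C₁ * C₃ + ρ 0

/-- `J = C₄² (M C₅² + M (M - 1) (C₅² - dmin²))`. -/
def constJ (M : ℕ) (ρ : ℝ → ℝ) (Lρ C₁ C₃ C₄ dmin : ℝ) : ℝ :=
  C₄ ^ 2 * ((M : ℝ) * constC5 ρ Lρ C₁ C₃ ^ 2 +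
    (M : ℝ) * ((M : ℝ) - 1) * (constC5 ρ Lρ C₁ C₃ ^ 2 - dmin ^ 2))

/-- `A = 4 D (2 L_ρ C₁₃₄ + C₄ |ρ(0)|) M` with `C₁₃₄ = C₁ C₃ C₄`. -/
def constA (M D : ℕ) (ρ : ℝ → ℝ) (Lρ C₁ C₃ C₄ : ℝ) : ℝ :=
  4 * (D : ℝ) * (2 * Lρ * (C₁ * C₃ * C₄) + C₄ * |ρ 0|) * (M : ℝ)

end

/-! ### Rademacher averages: contraction, Khinchine, ridge functions. -/

section Rademacher

open Finset
open scoped BigOperators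

/-! Let `b = √J` and consider the excess losses g_θ = ℓ_θ - ℓ_{f*}. An empirical minimizer satisfies
∑ g_θ(z_i) ≤ 0, so N (L(f̂) - L(f*)) is at most the one-sided uniform deviation sup_θ ∑ (𝔼 g_θ -
g_θ(z_i)). Working with differences makes a single one-sided bound enough.

Diversity enters through (∑ φ_m)² = M ∑ φ_m² - ½ ∑ (φ_n - φ_m)², which gives |f_k| ≤ b
(`abs_network_le`). Hence |g_θ| ≤ c = D/2 (b + C₂)², and each coordinate loss is (b + C₂)-Lipschitz
in the output.

The deviation exceeds its mean by ε with probability at most exp(-ε² / (2Nc²)) by McDiarmid, since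
one sample changes it by at most 2c. Its mean is at most twice the Rademacher average by
symmetrization. Contraction removes the square, |v_{k,m}| ≤ C₄ decouples the hidden units, a second
contraction removes ρ, and Khinchine bounds the remaining linear average by a multiple of √N
(`expect_iSup_excess_squaredLoss_le`).

Suprema are taken over finite families first, so that measurability is immediate.
`exists_measurableSet_uniform_deviation` then passes to the whole class along a dense sequence of
parameters. -/

/-- Averaging over `n + 1` signs, one sign at a time. -/
lemma expect_sign_succ {n : ℕ} (G : (Fin (n + 1) → ℤˣ) → ℝ) :
    𝔼 σ, G σ = ((𝔼 σ : Fin n → ℤˣ, G (Fin.cons 1 σ)) + 𝔼 σ, G (Fin.cons (-1) σ)) / 2 := by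
  have h : ∑ σ, G σ = (∑ σ : Fin n → ℤˣ, G (Fin.cons 1 σ)) + ∑ σ, G (Fin.cons (-1) σ) := by
    rw [← (Fin.consEquiv (fun _ : Fin (n + 1) => ℤˣ)).sum_comp, Fintype.sum_prod_type,
      show (univ : Finset ℤˣ) = {1, -1} from rfl, sum_pair (by decide)]
    rfl
  rw [Fintype.expect_eq_sum_div_card, Fintype.expect_eq_sum_div_card,
    Fintype.expect_eq_sum_div_card, h]
  simp only [Fintype.card_pi, Fintype.card_units_int, prod_const, card_univ, Fintype.card_fin]
  push_cast
  rw [pow_succ]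
  field_simp

lemma le_iSup_of_finite {ι : Type*} [Finite ι] (v : ι → ℝ) (s : ι) : v s ≤ ⨆ t, v t :=
  le_ciSup (Set.finite_range v).bddAbove s

lemma exists_eq_iSup_of_finite {ι : Type*} [Finite ι] [Nonempty ι] (v : ι → ℝ) :
    ∃ s, ⨆ t, v t = v s := by
  obtain ⟨s, hs⟩ := Set.Nonempty.csSup_mem (Set.range_nonempty v) (Set.finite_range v)
  exact ⟨s, hs.symm⟩

lemma iSup_add_le_of_finite {ι : Type*} [Finite ι] [Nonempty ι] (u v : ι → ℝ) :
    ⨆ t, (u t + v t) ≤ (⨆ t, u t) + ⨆ t, v t :=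
  ciSup_le fun t => add_le_add (le_iSup_of_finite u t) (le_iSup_of_finite v t)

lemma iSup_sum_le_of_finite {ι κ : Type*} [Finite ι] [Nonempty ι] (s : Finset κ)
    (u : κ → ι → ℝ) : ⨆ t, ∑ k ∈ s, u k t ≤ ∑ k ∈ s, ⨆ t, u k t :=
  ciSup_le fun t => sum_le_sum fun k _ => le_iSup_of_finite (u k) t

/-- The two-point comparison behind the contraction principle. -/
lemma iSup_add_add_iSup_sub_le {ι : Type*} [Finite ι] [Nonempty ι] (u a b : ι → ℝ)
    (h : ∀ s t, |b s - b t| ≤ |a s - a t|) :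
    (⨆ t, (u t + b t)) + ⨆ t, (u t - b t) ≤ (⨆ t, (u t + a t)) + ⨆ t, (u t - a t) := by
  -- The maximizers s, t on the left are tested on the right as (s, t) or as (t, s), according to
  -- the sign of a s - a t.
  obtain ⟨s, hs⟩ := exists_eq_iSup_of_finite fun t => u t + b t
  obtain ⟨t, ht⟩ := exists_eq_iSup_of_finite fun t => u t - b t
  rw [hs, ht]
  have h1 := le_iSup_of_finite (fun t => u t + a t) s
  have h2 := le_iSup_of_finite (fun t => u t - a t) t
  have h3 := le_iSup_of_finite (fun t => u t + a t) t
  have h4 := le_iSup_of_finite (fun t => u t - a t) s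
  have h5 := (le_abs_self _).trans (h s t)
  rcases abs_cases (a s - a t) with h6 | h6 <;> linarith

/-- The contraction principle for Rademacher averages of a finite class. -/
lemma expect_iSup_contraction {ι : Type*} [Finite ι] [Nonempty ι] {n : ℕ}
    (a b : Fin n → ι → ℝ) (h : ∀ i s t, |b i s - b i t| ≤ |a i s - a i t|) (u : ι → ℝ) :
    𝔼 σ : Fin n → ℤˣ, ⨆ t, (u t + ∑ i, ((σ i : ℤ) : ℝ) * b i t) ≤
      𝔼 σ : Fin n → ℤˣ, ⨆ t, (u t + ∑ i, ((σ i : ℤ) : ℝ) * a i t) := by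
  induction n generalizing u with
  | zero => simp
  | succ n ih =>
    rw [expect_sign_succ, expect_sign_succ]
    simp only [Fin.sum_univ_succ, Fin.cons_zero, Fin.cons_succ, Units.val_one, Units.val_neg,
      Int.cast_one, Int.cast_neg, one_mul, neg_mul, ← add_assoc]
    -- The free offset u absorbs ± b 0 while the induction hypothesis turns the other coordinates
    -- into a; the two-point comparison then replaces b 0 by a 0.
    have ih1 := ih (fun i => a i.succ) (fun i => b i.succ) (fun i => h i.succ)
      (fun t => u t + b 0 t)
    have ih2 := ih (fun i => a i.succ) (fun i => b i.succ) (fun i => h i.succ)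
      (fun t => u t + -b 0 t)
    refine div_le_div_of_nonneg_right ((add_le_add ih1 ih2).trans ?_) zero_le_two
    rw [← expect_add_distrib, ← expect_add_distrib]
    refine expect_le_expect fun σ _ => ?_
    refine (le_of_eq ?_).trans ((iSup_add_add_iSup_sub_le
      (fun t => u t + ∑ i, ((σ i : ℤ) : ℝ) * a i.succ t) (a 0) (b 0) (h 0)).trans (le_of_eq ?_)) <;>
    exact congrArg₂ (· + ·) (iSup_congr fun t => by ring) (iSup_congr fun t => by ring)

/-- Averaging over one sign is the parallelogram law; the offset u is what lets the induction run.
-/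
lemma expect_sq_norm_sum_sign {V : Type*} [NormedAddCommGroup V] [InnerProductSpace ℝ V] {n : ℕ}
    (x : Fin n → V) (u : V) :
    𝔼 σ : Fin n → ℤˣ, ‖u + ∑ i, ((σ i : ℤ) : ℝ) • x i‖ ^ 2 = ‖u‖ ^ 2 + ∑ i, ‖x i‖ ^ 2 := by
  induction n generalizing u with
  | zero => simp
  | succ n ih =>
    rw [expect_sign_succ]
    simp only [Fin.sum_univ_succ, Fin.cons_zero, Fin.cons_succ, Units.val_one, Units.val_neg,
      Int.cast_one, Int.cast_neg, one_smul, neg_smul, ← add_assoc]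
    rw [ih (fun i => x i.succ) (u + x 0), ih (fun i => x i.succ) (u + -x 0), ← sub_eq_add_neg]
    have := parallelogram_law_with_norm ℝ u (x 0)
    linarith

/-- Khinchine's upper bound in a Hilbert space. -/
lemma expect_norm_sum_sign_le {V : Type*} [NormedAddCommGroup V] [InnerProductSpace ℝ V] {n : ℕ}
    (x : Fin n → V) {C : ℝ} (hC : 0 ≤ C) (hx : ∀ i, ‖x i‖ ≤ C) :
    𝔼 σ : Fin n → ℤˣ, ‖∑ i, ((σ i : ℤ) : ℝ) • x i‖ ≤ C * √n := by
  have h1 := expect_sq_norm_sum_sign x 0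
  have h2 := expect_mul_sq_le_sq_mul_sq univ (fun _ : Fin n → ℤˣ => (1 : ℝ))
    (fun σ => ‖∑ i, ((σ i : ℤ) : ℝ) • x i‖)
  simp only [zero_add, norm_zero] at h1
  simp only [one_mul, one_pow, Fintype.expect_const, h1] at h2
  have h3 : ∑ i, ‖x i‖ ^ 2 ≤ n * C ^ 2 := by
    have := sum_le_sum (s := univ) fun i _ => pow_le_pow_left₀ (norm_nonneg _) (hx i) 2
    simpa using this
  refine abs_le_of_sq_le_sq' ?_ (by positivity) |>.2
  rw [mul_pow, Real.sq_sqrt (Nat.cast_nonneg n)]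
  linarith

lemma expect_sign_neg {n : ℕ} (G : (Fin n → ℤˣ) → ℝ) : 𝔼 σ, G (-σ) = 𝔼 σ, G σ :=
  Fintype.expect_equiv (Equiv.neg _) _ _ fun _ => rfl

/-- The Rademacher average of the ridge functions `x ↦ ψ ⟪w, x⟫` with `ψ` Lipschitz. -/
lemma expect_iSup_ridge_le {ι V : Type*} [Finite ι] [Nonempty ι] [NormedAddCommGroup V]
    [InnerProductSpace ℝ V] {n : ℕ} (x : Fin n → V) (w : ι → V) (ψ : ℝ → ℝ) (L : NNReal)
    (hψ : LipschitzWith L ψ) {C C' : ℝ} (hC : 0 ≤ C) (hx : ∀ i, ‖x i‖ ≤ C) (hw : ∀ t, ‖w t‖ ≤ C') :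
    𝔼 σ : Fin n → ℤˣ, ⨆ t, ∑ i, ((σ i : ℤ) : ℝ) * ψ (inner ℝ (w t) (x i)) ≤
      L * C * C' * √n := by
  have hC' : 0 ≤ C' := (norm_nonneg _).trans (hw (Classical.arbitrary ι))
  have h1 := expect_iSup_contraction (fun i t => (L : ℝ) * inner ℝ (w t) (x i))
    (fun i t => ψ (inner ℝ (w t) (x i))) (fun i s t => by
      have := hψ.dist_le_mul (inner ℝ (w s) (x i)) (inner ℝ (w t) (x i))
      rwa [Real.dist_eq, Real.dist_eq, ← abs_of_nonneg L.coe_nonneg, ← abs_mul, mul_sub] at this)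
    (fun _ => 0)
  simp only [zero_add] at h1
  refine h1.trans ?_
  have h2 : ∀ σ : Fin n → ℤˣ, ⨆ t, ∑ i, ((σ i : ℤ) : ℝ) * ((L : ℝ) * inner ℝ (w t) (x i)) ≤
      L * C' * ‖∑ i, ((σ i : ℤ) : ℝ) • x i‖ := fun σ => ciSup_le fun t => by
    have h3 : ∑ i, ((σ i : ℤ) : ℝ) * ((L : ℝ) * inner ℝ (w t) (x i)) =
        L * inner ℝ (w t) (∑ i, ((σ i : ℤ) : ℝ) • x i) := by
      simp only [inner_sum, inner_smul_right, mul_sum]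
      exact sum_congr rfl fun i _ => by ring
    rw [h3, mul_assoc]
    refine mul_le_mul_of_nonneg_left ((real_inner_le_norm _ _).trans ?_) L.coe_nonneg
    exact mul_le_mul_of_nonneg_right (hw t) (norm_nonneg _)
  refine (expect_le_expect fun σ _ => h2 σ).trans ?_
  rw [← mul_expect]
  calc _ ≤ (L : ℝ) * C' * (C * √n) :=
        mul_le_mul_of_nonneg_left (expect_norm_sum_sign_le x hC hx) (by positivity)
    _ = _ := by ring

/-- The absolute Rademacher average of the hidden units `x ↦ ρ ⟪w, x⟫`. -/
lemma expect_iSup_abs_ridge_le {ι V : Type*} [Finite ι] [Nonempty ι] [NormedAddCommGroup V]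
    [InnerProductSpace ℝ V] {n : ℕ} (x : Fin n → V) (w : ι → V) (ρ : ℝ → ℝ) (L : NNReal)
    (hρ : LipschitzWith L ρ) {C C' : ℝ} (hC : 0 ≤ C) (hx : ∀ i, ‖x i‖ ≤ C) (hw : ∀ t, ‖w t‖ ≤ C') :
    𝔼 σ : Fin n → ℤˣ, ⨆ t, |∑ i, ((σ i : ℤ) : ℝ) * ρ (inner ℝ (w t) (x i))| ≤
      (2 * L * C * C' + |ρ 0|) * √n := by
  have hC' : 0 ≤ C' := (norm_nonneg _).trans (hw (Classical.arbitrary ι))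
  -- Adjoining the zero weight, where ρ - ρ 0 vanishes, makes the suprema of P and of -P
  -- nonnegative. Each then dominates its part of |P| and their sum dominates |P|, whence the factor
  -- 2.
  let w' : Option ι → V := fun o => o.elim 0 w
  have hw' : ∀ o, ‖w' o‖ ≤ C' := by
    rintro (_ | t)
    · simpa [w'] using hC'
    · exact hw t
  have hψ : LipschitzWith L fun s => ρ s - ρ 0 :=
    LipschitzWith.of_dist_le_mul fun s t => by simpa [dist_sub_right] using hρ.dist_le_mul s t
  have hψ' : LipschitzWith L fun s => -(ρ s - ρ 0) :=
    LipschitzWith.of_dist_le_mul fun s t => by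
      rw [dist_neg_neg]; exact hψ.dist_le_mul s t
  have h1 := expect_iSup_ridge_le x w' _ L hψ hC hx hw'
  have h2 := expect_iSup_ridge_le x w' _ L hψ' hC hx hw'
  have h3 := expect_norm_sum_sign_le (fun _ : Fin n => ρ 0) (abs_nonneg (ρ 0)) (fun _ => le_rfl)
  have key : ∀ σ : Fin n → ℤˣ, ⨆ t, |∑ i, ((σ i : ℤ) : ℝ) * ρ (inner ℝ (w t) (x i))| ≤
      (⨆ t, ∑ i, ((σ i : ℤ) : ℝ) * (ρ (inner ℝ (w' t) (x i)) - ρ 0)) +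
      (⨆ t, ∑ i, ((σ i : ℤ) : ℝ) * -(ρ (inner ℝ (w' t) (x i)) - ρ 0)) +
      ‖∑ i, ((σ i : ℤ) : ℝ) • ρ 0‖ := fun σ => ciSup_le fun t => by
    set P := fun t => ∑ i, ((σ i : ℤ) : ℝ) * (ρ (inner ℝ (w' t) (x i)) - ρ 0) with hP
    set P' := fun t => ∑ i, ((σ i : ℤ) : ℝ) * -(ρ (inner ℝ (w' t) (x i)) - ρ 0) with hP'
    have e0 : P none = 0 := by simp [hP, w']
    have e0' : P' none = 0 := by simp [hP', w']
    have e1 : P' (some t) = -P (some t) := by simp only [hP, hP', mul_neg, sum_neg_distrib]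
    have e2 : ∑ i, ((σ i : ℤ) : ℝ) * ρ (inner ℝ (w t) (x i)) =
        P (some t) + ∑ i, ((σ i : ℤ) : ℝ) • ρ 0 := by
      simp [hP, w', mul_sub]
    have l1 := le_iSup_of_finite P none
    have l2 := le_iSup_of_finite P' none
    have l3 := le_iSup_of_finite P (some t)
    have l4 := le_iSup_of_finite P' (some t)
    rw [e2]
    refine (abs_add_le _ _).trans (add_le_add ?_ le_rfl)
    exact abs_le.2 ⟨by linarith, by linarith⟩
  refine (expect_le_expect fun σ _ => key σ).trans ?_
  rw [expect_add_distrib, expect_add_distrib]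
  linarith

end Rademacher

/-! ### Concentration: McDiarmid's inequality. -/

section Concentration

open Finset
open scoped BigOperators

variable {Z : Type*} [MeasurableSpace Z]

lemma measurable_cons_prod {n : ℕ} :
    Measurable fun p : Z × (Fin n → Z) => (Fin.cons p.1 p.2 : Fin (n + 1) → Z) := by
  refine measurable_pi_iff.2 fun i => ?_
  refine Fin.cases ?_ (fun j => ?_) i
  · simpa using measurable_fst
  · simpa [Function.comp_def] using (measurable_pi_apply j).comp (measurable_snd (α := Z))

lemma integral_pi_succ_eq_integral_cons (Q : Measure Z) [IsProbabilityMeasure Q] {n : ℕ}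
    (f : (Fin (n + 1) → Z) → ℝ) (hf : Integrable f (Measure.pi fun _ => Q)) :
    ∫ S, f S ∂(Measure.pi fun _ => Q) =
      ∫ S, ∫ z, f (Fin.cons z S) ∂Q ∂(Measure.pi fun _ : Fin n => Q) := by
  have mp := (measurePreserving_piFinSuccAbove (fun _ : Fin (n + 1) => Q) 0).symm
  have e : ∀ p : Z × (Fin n → Z),
      (MeasurableEquiv.piFinSuccAbove (fun _ : Fin (n + 1) => Z) 0).symm p =
        (Fin.cons p.1 p.2 : Fin (n + 1) → Z) := fun p => by
    simp [MeasurableEquiv.piFinSuccAbove]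
    rfl
  have hi := (mp.integrable_comp_emb (MeasurableEquiv.measurableEmbedding _)).2 hf
  simp only [Function.comp_def] at hi
  rw [← mp.integral_comp', integral_prod_symm _ hi]
  simp only [e]

lemma integrable_of_measurable_of_abs_le {Ω : Type*} [MeasurableSpace Ω] {μ : Measure Ω}
    [IsFiniteMeasure μ] {f : Ω → ℝ} (hf : Measurable f) {B : ℝ} (hB : ∀ x, |f x| ≤ B) :
    Integrable f μ :=
  Integrable.of_bound hf.aestronglyMeasurable B (Filter.Eventually.of_forall hB)

lemma abs_integral_le_of_abs_le {Ω : Type*} [MeasurableSpace Ω] {μ : Measure Ω}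
    [IsProbabilityMeasure μ] {f : Ω → ℝ} {B : ℝ} (hB : ∀ x, |f x| ≤ B) : |∫ x, f x ∂μ| ≤ B := by
  simpa using norm_integral_le_of_norm_le_const (μ := μ) (f := f) (Filter.Eventually.of_forall hB)

lemma integrable_exp_mul_of_abs_le {Ω : Type*} [MeasurableSpace Ω] {μ : Measure Ω}
    [IsFiniteMeasure μ] {f : Ω → ℝ} (hf : Measurable f) {B : ℝ} (hB : ∀ x, |f x| ≤ B) (t m : ℝ) :
    Integrable (fun x => Real.exp (t * (f x - m))) μ :=
  ProbabilityTheory.integrable_exp_mul_of_mem_Icc (a := -B - m) (b := B - m)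
    (hf.sub_const m).aemeasurable (Filter.Eventually.of_forall fun x => by
      have := abs_le.1 (hB x)
      constructor <;> linarith)

/-- Hoeffding's lemma for a function of bounded oscillation. -/
lemma integral_exp_le_of_oscillation_le (Q : Measure Z) [IsProbabilityMeasure Q] {h : Z → ℝ}
    (hm : Measurable h) {c : ℝ} (hc : ∀ z z', |h z - h z'| ≤ c) (t : ℝ) :
    ∫ z, Real.exp (t * (h z - ∫ z, h z ∂Q)) ∂Q ≤ Real.exp (c ^ 2 * t ^ 2 / 8) := by
  obtain ⟨z₀⟩ : Nonempty Z := nonempty_of_isProbabilityMeasure Q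
  have hb : BddBelow (Set.range h) := ⟨h z₀ - c, by
    rintro _ ⟨z, rfl⟩
    have := (abs_le.1 (hc z₀ z)).2
    linarith⟩
  have : Nonempty Z := ⟨z₀⟩
  -- Oscillation at most c places all values in an interval of length c starting at the infimum.
  have h1 := (ProbabilityTheory.hasSubgaussianMGF_of_mem_Icc (μ := Q) (a := ⨅ z, h z)
    (b := (⨅ z, h z) + c) hm.aemeasurable (Filter.Eventually.of_forall fun z =>
      ⟨ciInf_le hb z, by
        have : h z - c ≤ ⨅ z, h z := le_ciInf fun z' => by
          have := (abs_le.1 (hc z z')).2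
          linarith
        linarith⟩)).mgf_le t
  refine h1.trans (le_of_eq ?_)
  congr 1
  push_cast
  rw [add_sub_cancel_left, div_pow, Real.norm_eq_abs, sq_abs]
  ring

/-- The exponential moment bound of McDiarmid's inequality. -/
lemma integral_exp_le_of_bounded_differences (Q : Measure Z) [IsProbabilityMeasure Q] {n : ℕ}
    {f : (Fin n → Z) → ℝ} (hf : Measurable f) {B c : ℝ} (hB : ∀ S, |f S| ≤ B)
    (hc : ∀ S i z, |f (Function.update S i z) - f S| ≤ c) (t : ℝ) :
    ∫ S, Real.exp (t * (f S - ∫ S, f S ∂(Measure.pi fun _ => Q))) ∂(Measure.pi fun _ => Q) ≤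
      Real.exp (n * c ^ 2 * t ^ 2 / 8) := by
  induction n with
  | zero =>
    have : ∀ S, f S = f default := fun S => by rw [Subsingleton.elim S default]
    simp [this]
  | succ n ih =>
    have hcons : Measurable fun p : Z × (Fin n → Z) => f (Fin.cons p.1 p.2) :=
      hf.comp measurable_cons_prod
    -- Integrating out the first coordinate preserves both the bound and the bounded differences.
    -- Hoeffding's lemma in that coordinate costs one factor exp(c²t²/8), and the induction
    -- hypothesis handles g.
    set g : (Fin n → Z) → ℝ := fun S => ∫ z, f (Fin.cons z S) ∂Q with hg
    have hgm : Measurable g :=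
      (hcons.stronglyMeasurable.integral_prod_left' (μ := Q)).measurable
    have hfz : ∀ S : Fin n → Z, Measurable fun z => f (Fin.cons z S) := fun S =>
      hcons.comp (measurable_id.prodMk measurable_const)
    have hgB : ∀ S, |g S| ≤ B := fun S => abs_integral_le_of_abs_le fun z => hB _
    have hgc : ∀ S i z, |g (Function.update S i z) - g S| ≤ c := fun S i z => by
      rw [hg, ← integral_sub (integrable_of_measurable_of_abs_le (hfz _) fun _ => hB _)
        (integrable_of_measurable_of_abs_le (hfz _) fun _ => hB _)]
      refine abs_integral_le_of_abs_le fun w => ?_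
      rw [Fin.cons_update]
      exact hc _ _ _
    have hm : ∫ S, f S ∂(Measure.pi fun _ => Q) = ∫ S, g S ∂(Measure.pi fun _ => Q) :=
      integral_pi_succ_eq_integral_cons Q f (integrable_of_measurable_of_abs_le hf hB)
    rw [hm]
    set m := ∫ S, g S ∂(Measure.pi fun _ => Q)
    rw [integral_pi_succ_eq_integral_cons Q _ (integrable_exp_mul_of_abs_le hf hB t m)]
    have step : ∀ S : Fin n → Z, ∫ z, Real.exp (t * (f (Fin.cons z S) - m)) ∂Q ≤
        Real.exp (t * (g S - m)) * Real.exp (c ^ 2 * t ^ 2 / 8) := fun S => by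
      have h1 := integral_exp_le_of_oscillation_le Q (hfz S) (c := c) (fun z z' => by
        simpa using hc (Fin.cons z' S : Fin (n + 1) → Z) 0 z) t
      refine le_trans (le_of_eq ?_) (mul_le_mul_of_nonneg_left h1 (Real.exp_pos _).le)
      rw [← integral_const_mul]
      refine integral_congr_ae (Filter.Eventually.of_forall fun z => ?_)
      simp only [← Real.exp_add]
      congr 1
      ring
    calc _ ≤ ∫ S, Real.exp (t * (g S - m)) * Real.exp (c ^ 2 * t ^ 2 / 8)
          ∂(Measure.pi fun _ => Q) :=
          integral_mono_of_nonneg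
            (Filter.Eventually.of_forall fun S => integral_nonneg fun z => (Real.exp_pos _).le)
            ((integrable_exp_mul_of_abs_le hgm hgB t m).mul_const _)
            (Filter.Eventually.of_forall step)
      _ ≤ Real.exp (n * c ^ 2 * t ^ 2 / 8) * Real.exp (c ^ 2 * t ^ 2 / 8) := by
          rw [integral_mul_const]
          exact mul_le_mul_of_nonneg_right (ih hgm hgB hgc) (Real.exp_pos _).le
      _ = _ := by
          rw [← Real.exp_add]
          congr 1
          push_cast
          ring

/-- McDiarmid's inequality. -/
lemma measureReal_ge_le_of_bounded_differences (Q : Measure Z) [IsProbabilityMeasure Q] {n : ℕ}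
    {f : (Fin n → Z) → ℝ} (hf : Measurable f) {B c : ℝ} (hB : ∀ S, |f S| ≤ B)
    (hc : ∀ S i z, |f (Function.update S i z) - f S| ≤ c) {ε : ℝ} (hε : 0 ≤ ε) :
    (Measure.pi fun _ => Q).real {S | ε ≤ f S - ∫ S, f S ∂(Measure.pi fun _ => Q)} ≤
      Real.exp (-(2 * ε ^ 2 / (n * c ^ 2))) := by
  have h : ProbabilityTheory.HasSubgaussianMGF
      (fun S => f S - ∫ S, f S ∂(Measure.pi fun _ => Q)) (n * (‖c‖₊ / 2) ^ 2)
      (Measure.pi fun _ => Q) :=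
    { integrable_exp_mul := fun t => integrable_exp_mul_of_abs_le hf hB t _
      mgf_le := fun t => by
        refine (integral_exp_le_of_bounded_differences Q hf hB hc t).trans (le_of_eq ?_)
        congr 1
        push_cast
        rw [div_pow, Real.norm_eq_abs, sq_abs]
        ring }
  refine (h.measure_ge_le hε).trans (le_of_eq ?_)
  congr 1
  push_cast
  rw [div_pow, Real.norm_eq_abs, sq_abs]
  -- When n c² = 0, both exponents are divisions by zero, hence 0, and the two bounds agree.
  rcases eq_or_ne ((n : ℝ) * c ^ 2) 0 with h0 | h0
  · rw [h0, show 2 * ((n : ℝ) * (c ^ 2 / 2 ^ 2)) = (n * c ^ 2) / 2 by ring, h0]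
    simp
  · have h1 := left_ne_zero_of_mul h0
    have h2 := right_ne_zero_of_mul h0
    field_simp

end Concentration

/-! ### Symmetrization and the deviation bound for finite classes. -/

section Symmetrization

open Finset
open scoped BigOperators

variable {Z : Type*} [MeasurableSpace Z]

lemma abs_iSup_le_of_finite {ι : Type*} [Finite ι] [Nonempty ι] {v : ι → ℝ} {C : ℝ}
    (h : ∀ t, |v t| ≤ C) : |⨆ t, v t| ≤ C := by
  obtain ⟨s, hs⟩ := exists_eq_iSup_of_finite v
  rw [hs]
  exact h s

lemma measurable_iSup_deviation (Q : Measure Z) {n : ℕ} {ι : Type*} [Finite ι] {g : ι → Z → ℝ}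
    (hg : ∀ t, Measurable (g t)) :
    Measurable fun S : Fin n → Z => ⨆ t, ∑ i, (∫ z, g t z ∂Q - g t (S i)) :=
  Measurable.iSup fun t => Finset.measurable_sum _ fun i _ =>
    ((hg t).comp (measurable_pi_apply i)).const_sub _

lemma abs_iSup_deviation_le (Q : Measure Z) [IsProbabilityMeasure Q] {n : ℕ} {ι : Type*}
    [Finite ι] [Nonempty ι] {g : ι → Z → ℝ} {c : ℝ} (hc : ∀ t z, |g t z| ≤ c) (S : Fin n → Z) :
    |⨆ t, ∑ i, (∫ z, g t z ∂Q - g t (S i))| ≤ n * (c + c) :=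
  abs_iSup_le_of_finite fun t => by
    refine (abs_sum_le_sum_abs _ _).trans ((sum_le_sum fun i _ =>
      (abs_sub _ _).trans (add_le_add (abs_integral_le_of_abs_le (hc t)) (hc t _))).trans ?_)
    simp [mul_add]

/-- Swapping the two samples in the coordinates where `σ = -1` preserves the product measure. -/
lemma integral_prod_pi_swap (Q : Measure Z) [IsProbabilityMeasure Q] {n : ℕ}
    {F : (Fin n → Z × Z) → ℝ} (hF : Measurable F) (σ : Fin n → ℤˣ) :
    ∫ P, F (fun i => if σ i = 1 then P i else (P i).swap) ∂(Measure.pi fun _ => Q.prod Q) =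
      ∫ P, F P ∂(Measure.pi fun _ => Q.prod Q) := by
  have hσ : ∀ i : Fin n, MeasurePreserving
      (fun p : Z × Z => if σ i = 1 then p else p.swap) (Q.prod Q) (Q.prod Q) := fun i => by
    split_ifs
    · exact MeasurePreserving.id _
    · exact Measure.measurePreserving_swap
  have h := measurePreserving_pi (fun _ : Fin n => Q.prod Q) (fun _ : Fin n => Q.prod Q) hσ
  have h' := integral_map h.aemeasurable hF.aestronglyMeasurable
  rw [h.map_eq] at h'
  exact h'.symm

lemma integral_expect {Ω κ : Type*} [MeasurableSpace Ω] {μ : Measure Ω} [Fintype κ]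
    {f : κ → Ω → ℝ} (hf : ∀ k, Integrable (f k) μ) :
    ∫ x, 𝔼 k, f k x ∂μ = 𝔼 k, ∫ x, f k x ∂μ := by
  simp only [Fintype.expect_eq_sum_div_card]
  rw [integral_div, integral_finsetSum _ fun k _ => hf k]

/-- Symmetrization: the expected uniform deviation is at most twice the Rademacher bound. -/
lemma integral_iSup_deviation_le (Q : Measure Z) [IsProbabilityMeasure Q] {n : ℕ}
    {ι : Type*} [Finite ι] [Nonempty ι] {g : ι → Z → ℝ} (hg : ∀ t, Measurable (g t)) {c R : ℝ}
    (hc : ∀ t z, |g t z| ≤ c)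
    (hR : ∀ S : Fin n → Z, 𝔼 σ : Fin n → ℤˣ, ⨆ t, ∑ i, ((σ i : ℤ) : ℝ) * g t (S i) ≤ R) :
    ∫ S, ⨆ t, ∑ i : Fin n, (∫ z, g t z ∂Q - g t (S i)) ∂(Measure.pi fun _ => Q) ≤ 2 * R := by
  have hev : ∀ t (i : Fin n), Measurable fun S : Fin n → Z => g t (S i) := fun t i =>
    (hg t).comp (measurable_pi_apply i)
  have hevi : ∀ t (i : Fin n), Integrable (fun S : Fin n → Z => g t (S i))
      (Measure.pi fun _ => Q) := fun t i =>
    integrable_of_measurable_of_abs_le (hev t i) fun S => hc t _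
  have heval : ∀ t (i : Fin n), ∫ S : Fin n → Z, g t (S i) ∂(Measure.pi fun _ => Q) =
      ∫ z, g t z ∂Q := fun t i => by
    have := (measurePreserving_eval (fun _ : Fin n => Q) i)
    have h := integral_map this.aemeasurable (hg t).aestronglyMeasurable
    rw [this.map_eq] at h
    exact h.symm
  set Ψ : (Fin n → Z × Z) → ℝ := fun P => ⨆ t, ∑ i, (g t (P i).2 - g t (P i).1)
  have hΨm : Measurable Ψ := Measurable.iSup fun t => Finset.measurable_sum _ fun i _ =>
    ((hg t).comp (measurable_snd.comp (measurable_pi_apply i))).sub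
      ((hg t).comp (measurable_fst.comp (measurable_pi_apply i)))
  have hΨB : ∀ P, |Ψ P| ≤ n * (c + c) := fun P => abs_iSup_le_of_finite fun t => by
    refine (abs_sum_le_sum_abs _ _).trans ((sum_le_sum fun i _ =>
      (abs_sub _ _).trans (add_le_add (hc t _) (hc t _))).trans ?_)
    simp [mul_add]
  have hpair : Measurable fun p : (Fin n → Z) × (Fin n → Z) => fun i => (p.1 i, p.2 i) :=
    measurable_pi_iff.2 fun i => ((measurable_pi_apply i).comp measurable_fst).prodMk
      ((measurable_pi_apply i).comp measurable_snd)
  -- Each mean is written as an average over a ghost sample S', and the supremum of an integral is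
  -- at most the integral of the supremum.
  have h1 : ∀ S : Fin n → Z, ⨆ t, ∑ i, (∫ z, g t z ∂Q - g t (S i)) ≤
      ∫ S', Ψ (fun i => (S i, S' i)) ∂(Measure.pi fun _ => Q) := fun S => ciSup_le fun t => by
    have e : ∑ i, (∫ z, g t z ∂Q - g t (S i)) =
        ∫ S' : Fin n → Z, ∑ i, (g t (S' i) - g t (S i)) ∂(Measure.pi fun _ => Q) := by
      rw [integral_finsetSum (f := fun i (S' : Fin n → Z) => g t (S' i) - g t (S i)) _
        fun i _ => (hevi t i).sub (integrable_const _)]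
      refine sum_congr rfl fun i _ => ?_
      rw [integral_sub (hevi t i) (integrable_const _), heval]
      simp
    rw [e]
    refine integral_mono (integrable_finsetSum _ fun i _ => (hevi t i).sub (integrable_const _))
      (integrable_of_measurable_of_abs_le
        (hΨm.comp (hpair.comp (measurable_const.prodMk measurable_id))) fun S' => hΨB _)
      fun S' => ?_
    exact le_iSup_of_finite (fun t => ∑ i, (g t (S' i) - g t (S i))) t
  have hprod : Integrable (fun p : (Fin n → Z) × (Fin n → Z) => Ψ fun i => (p.1 i, p.2 i))
      ((Measure.pi fun _ => Q).prod (Measure.pi fun _ => Q)) :=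
    integrable_of_measurable_of_abs_le (hΨm.comp hpair) fun _ => hΨB _
  have h2 : ∫ S, ⨆ t, ∑ i : Fin n, (∫ z, g t z ∂Q - g t (S i)) ∂(Measure.pi fun _ => Q) ≤
      ∫ P, Ψ P ∂(Measure.pi fun _ => Q.prod Q) := by
    refine (integral_mono (integrable_of_measurable_of_abs_le
      (measurable_iSup_deviation Q hg) (abs_iSup_deviation_le Q hc))
      hprod.integral_prod_left h1).trans (le_of_eq ?_)
    rw [← integral_prod _ hprod]
    have mp := measurePreserving_arrowProdEquivProdArrow Z Z (Fin n) (fun _ => Q) (fun _ => Q)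
    rw [← mp.integral_comp']
    rfl
  set Θ : (Fin n → ℤˣ) → (Fin n → Z × Z) → ℝ := fun σ P =>
    Ψ fun i => if σ i = 1 then P i else (P i).swap with hΘ
  have hΘm : ∀ σ, Measurable (Θ σ) := fun σ => hΨm.comp <| measurable_pi_iff.2 fun i => by
    split_ifs
    · exact measurable_pi_apply i
    · exact measurable_swap.comp (measurable_pi_apply i)
  have hΘi : ∀ σ, Integrable (Θ σ) (Measure.pi fun _ => Q.prod Q) := fun σ =>
    integrable_of_measurable_of_abs_le (hΘm σ) fun _ => hΨB _
  have h3 : ∫ P, Ψ P ∂(Measure.pi fun _ => Q.prod Q) =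
      ∫ P, 𝔼 σ, Θ σ P ∂(Measure.pi fun _ => Q.prod Q) := by
    rw [integral_expect hΘi]
    simp only [hΘ, integral_prod_pi_swap Q hΨm, Fintype.expect_const]
  have h4 : ∀ P, 𝔼 σ, Θ σ P ≤ 2 * R := fun P => by
    -- Swapping a pair flips the sign of its difference, so Θ σ carries the signs σ. The supremum
    -- splits over the two samples, and -σ ranges over the signs as σ does.
    have hσ : ∀ σ, Θ σ P ≤ (⨆ t, ∑ i, ((σ i : ℤ) : ℝ) * g t (P i).2) +
        ⨆ t, ∑ i, (((-σ) i : ℤ) : ℝ) * g t (P i).1 := fun σ => by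
      refine le_trans (le_of_eq (iSup_congr fun t => ?_)) (iSup_add_le_of_finite _ _)
      rw [← sum_add_distrib]
      refine sum_congr rfl fun i _ => ?_
      rcases Int.units_eq_one_or (σ i) with h | h <;> simp [h, sub_eq_add_neg, add_comm]
    refine (expect_le_expect fun σ _ => hσ σ).trans ?_
    rw [expect_add_distrib,
      expect_sign_neg fun σ : Fin n → ℤˣ => ⨆ t, ∑ i, ((σ i : ℤ) : ℝ) * g t (P i).1]
    have := hR fun i => (P i).1
    have := hR fun i => (P i).2
    linarith
  rw [h3] at h2
  refine h2.trans ?_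
  have h5 : Integrable (fun P => 𝔼 σ, Θ σ P) (Measure.pi fun _ : Fin n => Q.prod Q) := by
    simp only [Fintype.expect_eq_sum_div_card]
    exact (integrable_finsetSum _ fun σ _ => hΘi σ).div_const _
  simpa using integral_mono h5 (integrable_const (2 * R)) h4

/-- The uniform deviation bound for a finite class of bounded functions. -/
lemma measureReal_iSup_deviation_ge_le (Q : Measure Z) [IsProbabilityMeasure Q] {n : ℕ}
    {ι : Type*} [Finite ι] [Nonempty ι] {g : ι → Z → ℝ} (hg : ∀ t, Measurable (g t)) {c R : ℝ}
    (hc : ∀ t z, |g t z| ≤ c)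
    (hR : ∀ S : Fin n → Z, 𝔼 σ : Fin n → ℤˣ, ⨆ t, ∑ i, ((σ i : ℤ) : ℝ) * g t (S i) ≤ R)
    {ε : ℝ} (hε : 0 ≤ ε) :
    (Measure.pi fun _ => Q).real
        {S | 2 * R + ε ≤ ⨆ t, ∑ i : Fin n, (∫ z, g t z ∂Q - g t (S i))} ≤
      Real.exp (-(ε ^ 2 / (2 * n * c ^ 2))) := by
  set f : (Fin n → Z) → ℝ := fun S => ⨆ t, ∑ i, (∫ z, g t z ∂Q - g t (S i)) with hf
  have hupd : ∀ t (S : Fin n → Z) i z, ∑ j, (∫ z, g t z ∂Q - g t (Function.update S i z j)) =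
      ∑ j, (∫ z, g t z ∂Q - g t (S j)) + (g t (S i) - g t z) := fun t S i z => by
    rw [← sub_eq_iff_eq_add', ← sum_sub_distrib, sum_eq_single i]
    · simp
    · intro j _ hj
      simp [hj]
    · simp
  have hlip : ∀ t z z', g t z - g t z' ≤ 2 * c := fun t z z' => by
    have := abs_le.1 (hc t z)
    have := abs_le.1 (hc t z')
    linarith
  have hfd : ∀ S i z, |f (Function.update S i z) - f S| ≤ 2 * c := fun S i z => by
    rw [abs_sub_le_iff]
    constructor
    · rw [sub_le_iff_le_add]
      refine ciSup_le fun t => ?_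
      rw [hupd]
      have h1 := le_iSup_of_finite (fun t => ∑ j, (∫ z, g t z ∂Q - g t (S j))) t
      have h2 := hlip t (S i) z
      simp only [hf]
      linarith
    · rw [sub_le_iff_le_add]
      refine ciSup_le fun t => ?_
      have h1 := le_iSup_of_finite
        (fun t => ∑ j, (∫ z, g t z ∂Q - g t (Function.update S i z j))) t
      have h2 := hlip t z (S i)
      simp only [hupd] at h1
      simp only [hf, hupd]
      linarith
  have h := measureReal_ge_le_of_bounded_differences Q (measurable_iSup_deviation Q hg)
    (abs_iSup_deviation_le Q hc) hfd hε
  have hm := integral_iSup_deviation_le Q hg hc hR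
  refine (measureReal_mono fun S hS => ?_).trans (h.trans (le_of_eq ?_))
  · simp only [Set.mem_ofPred_eq] at hS ⊢
    linarith
  · congr 2
    rw [show (n : ℝ) * (2 * c) ^ 2 = 2 * (2 * n * c ^ 2) by ring]
    exact mul_div_mul_left _ _ two_ne_zero

end Symmetrization

/-! ### From finite families to separable classes. -/

section SeparableClass

open Finset
open scoped BigOperators

variable {Z : Type*} [MeasurableSpace Z]

/-- The uniform deviation bound for a separable class of bounded functions depending continuously
on the parameter. -/
lemma exists_measurableSet_uniform_deviation (Q : Measure Z) [IsProbabilityMeasure Q] {n : ℕ}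
    {Θ : Type*} [TopologicalSpace Θ] [TopologicalSpace.SeparableSpace Θ] [FirstCountableTopology Θ]
    [Nonempty Θ] {G : Θ → Z → ℝ}
    (hG : ∀ t, Measurable (G t)) (hGc : ∀ z, Continuous fun t => G t z) {c R : ℝ}
    (hc : ∀ t z, |G t z| ≤ c)
    (hR : ∀ (m : ℕ) (s : Fin (m + 1) → Θ) (S : Fin n → Z),
      𝔼 σ : Fin n → ℤˣ, ⨆ t, ∑ i, ((σ i : ℤ) : ℝ) * G (s t) (S i) ≤ R)
    {ε η : ℝ} (hε : 0 ≤ ε) (hη : Real.exp (-(ε ^ 2 / (2 * n * c ^ 2))) ≤ η) :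
    ∃ E : Set (Fin n → Z), MeasurableSet E ∧
      ENNReal.ofReal (1 - η) ≤ Measure.pi (fun _ : Fin n => Q) E ∧
      ∀ S ∈ E, ∀ t, ∑ i, (∫ z, G t z ∂Q - G t (S i)) ≤ 2 * R + ε := by
  let d := TopologicalSpace.denseSeq Θ
  let s : (m : ℕ) → Fin (m + 1) → Θ := fun m j => d j
  let A : ℕ → Set (Fin n → Z) := fun m =>
    {S | 2 * R + ε ≤ ⨆ t, ∑ i : Fin n, (∫ z, G (s m t) z ∂Q - G (s m t) (S i))}
  have hAm : ∀ m, MeasurableSet (A m) := fun m =>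
    measurableSet_le measurable_const (measurable_iSup_deviation Q fun t => hG (s m t))
  -- The bad events of growing initial segments of the dense sequence increase, so their union is
  -- still bounded by η, with no union bound.
  have hAmono : Monotone A := fun m m' hmm S hS => by
    refine le_trans (Set.mem_ofPred_eq.mp hS) (ciSup_le fun t => ?_)
    exact le_iSup_of_finite
      (fun t => ∑ i : Fin n, (∫ z, G (s m' t) z ∂Q - G (s m' t) (S i)))
      (Fin.castLE (by omega) t)
  have hAle : ∀ m, (Measure.pi fun _ => Q) (A m) ≤ ENNReal.ofReal η := fun m => by
    have h := (measureReal_iSup_deviation_ge_le Q (fun t => hG (s m t)) (fun t => hc (s m t))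
      (hR m (s m)) hε).trans hη
    rw [← ofReal_measureReal]
    exact ENNReal.ofReal_le_ofReal h
  refine ⟨(⋃ m, A m)ᶜ, (MeasurableSet.iUnion hAm).compl, ?_, fun S hS t => ?_⟩
  · rw [prob_compl_eq_one_sub (MeasurableSet.iUnion hAm), hAmono.measure_iUnion,
      ENNReal.ofReal_sub _ ((Real.exp_pos _).le.trans hη), ENNReal.ofReal_one]
    exact tsub_le_tsub_left (iSup_le hAle) _
  -- The deviation is continuous in the parameter, so the inequality on the dense sequence extends
  -- to every t.
  · have hint : Continuous fun t => ∫ z, G t z ∂Q :=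
      continuous_of_dominated (fun t => (hG t).aestronglyMeasurable)
        (fun t => Filter.Eventually.of_forall fun z => hc t z) (integrable_const c)
        (Filter.Eventually.of_forall hGc)
    refine (TopologicalSpace.denseRange_denseSeq Θ).induction_on
      (p := fun t => ∑ i, (∫ z, G t z ∂Q - G t (S i)) ≤ 2 * R + ε) t
      (isClosed_le (continuous_finsetSum _ fun i _ => hint.sub (hGc _)) continuous_const)
      fun m => ?_
    have h : S ∉ A m := fun h => hS (Set.mem_iUnion.2 ⟨m, h⟩)
    refine le_trans ?_ (not_le.1 h).le
    exact le_iSup_of_finite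
      (fun t => ∑ i : Fin n, (∫ z, G (s m t) z ∂Q - G (s m t) (S i))) (Fin.last m)

end SeparableClass

/-! ### Bounds for networks and their losses. -/

section Network

open Finset
open scoped BigOperators

lemma hiddenFeature_nonneg {p M : ℕ} {ρ : ℝ → ℝ} (hρ_nonneg : ∀ t, 0 ≤ ρ t)
    (W : Fin M → EuclideanSpace ℝ (Fin p)) (m : Fin M) (x : EuclideanSpace ℝ (Fin p)) :
    0 ≤ hiddenFeature ρ W m x :=
  hρ_nonneg _

lemma abs_hiddenFeature_le {p M : ℕ} {ρ : ℝ → ℝ} {L : NNReal} (hρ_nonneg : ∀ t, 0 ≤ ρ t)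
    (hρ : LipschitzWith L ρ) {C₁ C₃ : ℝ} {W : Fin M → EuclideanSpace ℝ (Fin p)} {m : Fin M}
    (hW : ‖W m‖ ≤ C₃) {x : EuclideanSpace ℝ (Fin p)} (hx : ‖x‖ ≤ C₁) :
    |hiddenFeature ρ W m x| ≤ constC5 ρ L C₁ C₃ := by
  rw [hiddenFeature, abs_of_nonneg (hρ_nonneg _), constC5]
  have h1 := (le_abs_self _).trans (hρ.dist_le_mul (inner ℝ (W m) x) 0)
  rw [dist_zero_right] at h1
  have h2 : ‖inner ℝ (W m) x‖ ≤ C₁ * C₃ := (norm_inner_le_norm _ _).trans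
    ((mul_le_mul hW hx (norm_nonneg _) ((norm_nonneg _).trans hW)).trans (mul_comm _ _).le)
  have h3 := mul_le_mul_of_nonneg_left h2 L.coe_nonneg
  have h4 := (le_abs_self _).trans ((Real.dist_eq _ _).symm.le.trans
    (hρ.dist_le_mul (inner ℝ (W m) x) 0))
  rw [dist_zero_right] at h4
  linarith

/-- Feature diversity bounds the squared sum of the features. -/
lemma sq_sum_hiddenFeature_le {p M : ℕ} (hM : 2 ≤ M) {ρ : ℝ → ℝ} {C dmin : ℝ}
    {W : Fin M → EuclideanSpace ℝ (Fin p)} {x : EuclideanSpace ℝ (Fin p)}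
    (hC : ∀ m, |hiddenFeature ρ W m x| ≤ C) (hd : dmin ^ 2 ≤ featureDiversity ρ W x) :
    (∑ m, hiddenFeature ρ W m x) ^ 2 ≤
      (M : ℝ) * C ^ 2 + (M : ℝ) * ((M : ℝ) - 1) * (C ^ 2 - dmin ^ 2) := by
  set φ := fun m => hiddenFeature ρ W m x
  have hM' : (2 : ℝ) ≤ M := by exact_mod_cast hM
  have hpos : 0 < 2 * (M : ℝ) * ((M : ℝ) - 1) := by
    have : (0 : ℝ) < M - 1 := by linarith
    positivity
  have e1 : ∀ n m, (if n ≠ m then (φ n - φ m) ^ 2 else 0) = (φ n - φ m) ^ 2 := fun n m => by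
    split_ifs with h
    · rfl
    · rw [not_not.1 h]; simp
  have e2 : ∑ n, ∑ m, (φ n - φ m) ^ 2 = 2 * M * ∑ m, φ m ^ 2 - 2 * (∑ m, φ m) ^ 2 := by
    simp only [sub_sq, sum_add_distrib, sum_sub_distrib, sum_const, card_univ, Fintype.card_fin,
      nsmul_eq_mul, ← mul_sum, ← sum_mul]
    ring
  have hd' : dmin ^ 2 * (2 * M * (M - 1)) ≤ ∑ n, ∑ m, (φ n - φ m) ^ 2 := by
    rw [← le_div_iff₀ hpos]
    refine hd.trans (le_of_eq ?_)
    rw [featureDiversity, one_div, inv_mul_eq_div]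
    congr 1
    exact sum_congr rfl fun n _ => sum_congr rfl fun m _ => e1 n m
  have hs : ∑ m, φ m ^ 2 ≤ M * C ^ 2 := by
    have := sum_le_sum (s := univ) fun m _ => (sq_le_sq' (abs_le.1 (hC m)).1 (abs_le.1 (hC m)).2)
    simpa using this
  have hs' := mul_le_mul_of_nonneg_left hs (by linarith : (0 : ℝ) ≤ M)
  rw [e2] at hd'
  have : (∑ m, φ m) ^ 2 ≤ M * (M * C ^ 2) - dmin ^ 2 * (M * (M - 1)) := by linarith
  refine this.trans (le_of_eq (by ring))

/-- As ρ ≥ 0, each output is at most C₄ times the plain sum of the features, the quantity that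
diversity controls. -/
lemma abs_network_le {p M D : ℕ} (hM : 2 ≤ M) {ρ : ℝ → ℝ} {L : NNReal}
    (hρ_nonneg : ∀ t, 0 ≤ ρ t) (hρ : LipschitzWith L ρ) {C₁ C₃ C₄ dmin : ℝ}
    {W : Fin M → EuclideanSpace ℝ (Fin p)} {V : Fin D → Fin M → ℝ} (hW : ∀ m, ‖W m‖ ≤ C₃)
    (hV : ∀ k m, |V k m| ≤ C₄) {x : EuclideanSpace ℝ (Fin p)} (hx : ‖x‖ ≤ C₁)
    (hd : dmin ^ 2 ≤ featureDiversity ρ W x) (k : Fin D) :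
    |network ρ W V x k| ≤ √(constJ M ρ L C₁ C₃ C₄ dmin) := by
  refine Real.abs_le_sqrt ?_
  have h1 : |network ρ W V x k| ≤ C₄ * ∑ m, hiddenFeature ρ W m x := by
    rw [mul_sum]
    refine (abs_sum_le_sum_abs (fun m => V k m * hiddenFeature ρ W m x) univ).trans
      (sum_le_sum fun m _ => ?_)
    rw [abs_mul, abs_of_nonneg (hiddenFeature_nonneg hρ_nonneg W m x)]
    exact mul_le_mul_of_nonneg_right (hV k m) (hiddenFeature_nonneg hρ_nonneg W m x)
  have h2 := pow_le_pow_left₀ (abs_nonneg _) h1 2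
  rw [sq_abs, mul_pow] at h2
  exact h2.trans (mul_le_mul_of_nonneg_left (sq_sum_hiddenFeature_le hM
    (fun m => abs_hiddenFeature_le hρ_nonneg hρ (hW m) hx) hd) (sq_nonneg _))

lemma squaredLoss_eq_sum {D : ℕ} (u y : EuclideanSpace ℝ (Fin D)) :
    squaredLoss u y = ∑ k, 1 / 2 * (u k - y k) ^ 2 := by
  rw [squaredLoss, EuclideanSpace.real_norm_sq_eq, mul_sum]
  rfl

lemma squaredLoss_nonneg {D : ℕ} (u y : EuclideanSpace ℝ (Fin D)) : 0 ≤ squaredLoss u y := by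
  unfold squaredLoss
  positivity

lemma squaredLoss_le {D : ℕ} {u y : EuclideanSpace ℝ (Fin D)} {b C : ℝ} (hu : ∀ k, |u k| ≤ b)
    (hy : ∀ k, |y k| ≤ C) : squaredLoss u y ≤ D / 2 * (b + C) ^ 2 := by
  rw [squaredLoss_eq_sum]
  have h : ∀ k, 1 / 2 * (u k - y k) ^ 2 ≤ 1 / 2 * (b + C) ^ 2 := fun k => by
    have := pow_le_pow_left₀ (abs_nonneg _) ((abs_sub _ _).trans (add_le_add (hu k) (hy k))) 2
    rw [sq_abs] at this
    linarith
  refine (sum_le_sum fun k _ => h k).trans (le_of_eq ?_)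
  simp
  ring

/-- The Rademacher average of the excess squared losses of a finite family of networks. -/
lemma expect_iSup_excess_squaredLoss_le {ι : Type*} [Finite ι] [Nonempty ι] {p M D n : ℕ}
    {ρ : ℝ → ℝ} {L : NNReal} (hρ : LipschitzWith L ρ) {C₁ C₂ C₃ C₄ b : ℝ} (hC₁ : 0 ≤ C₁)
    (hC₄ : 0 ≤ C₄) (hB : 0 ≤ b + C₂)
    (W : ι → Fin M → EuclideanSpace ℝ (Fin p)) (V : ι → Fin D → Fin M → ℝ)
    (hW : ∀ t m, ‖W t m‖ ≤ C₃) (hV : ∀ t k m, |V t k m| ≤ C₄)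
    (x : Fin n → EuclideanSpace ℝ (Fin p)) (y u : Fin n → EuclideanSpace ℝ (Fin D))
    (hx : ∀ i, ‖x i‖ ≤ C₁) (hy : ∀ i k, |y i k| ≤ C₂)
    (hb : ∀ t i k, |network ρ (W t) (V t) (x i) k| ≤ b) :
    𝔼 σ : Fin n → ℤˣ, ⨆ t, ∑ i, ((σ i : ℤ) : ℝ) *
        (squaredLoss (network ρ (W t) (V t) (x i)) (y i) - squaredLoss (u i) (y i)) ≤
      D * ((b + C₂) * C₄ * (M * ((2 * L * C₁ * C₃ + |ρ 0|) * √n))) := by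
  set ψ : Fin D → Fin n → ι → ℝ := fun k i t =>
    1 / 2 * (network ρ (W t) (V t) (x i) k - y i k) ^ 2 - 1 / 2 * (u i k - y i k) ^ 2 with hψ
  -- On outputs bounded by b, the map a ↦ ½(a - y)² has Lipschitz constant b + C₂; the reference
  -- loss does not depend on t and cancels in differences.
  have hψl : ∀ k i s t, |ψ k i s - ψ k i t| ≤
      |(b + C₂) * network ρ (W s) (V s) (x i) k - (b + C₂) * network ρ (W t) (V t) (x i) k| := by
    intro k i s t
    set a₁ := network ρ (W s) (V s) (x i) k with ha₁
    set a₂ := network ρ (W t) (V t) (x i) k with ha₂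
    have e : ψ k i s - ψ k i t = (a₁ - a₂) * ((a₁ + a₂) / 2 - y i k) := by
      simp only [hψ, ← ha₁, ← ha₂]
      ring
    rw [e, ← mul_sub, abs_mul, abs_mul, abs_of_nonneg hB, mul_comm]
    refine mul_le_mul_of_nonneg_right ?_ (abs_nonneg _)
    have h1 := abs_le.1 (hb s i k)
    have h2 := abs_le.1 (hb t i k)
    have h3 := abs_le.1 (hy i k)
    rw [abs_le]
    constructor <;> linarith
  have h1 : ∀ σ : Fin n → ℤˣ, ⨆ t, ∑ i, ((σ i : ℤ) : ℝ) *
      (squaredLoss (network ρ (W t) (V t) (x i)) (y i) - squaredLoss (u i) (y i)) ≤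
      ∑ k, ⨆ t, ∑ i, ((σ i : ℤ) : ℝ) * ψ k i t := fun σ => by
    refine le_trans (le_of_eq (iSup_congr fun t => ?_)) (iSup_sum_le_of_finite _ _)
    rw [sum_comm]
    refine sum_congr rfl fun i _ => ?_
    rw [← mul_sum, squaredLoss_eq_sum, squaredLoss_eq_sum, ← sum_sub_distrib]
  refine (expect_le_expect fun σ _ => h1 σ).trans ?_
  rw [expect_sum_comm]
  have h2 : ∀ k, 𝔼 σ : Fin n → ℤˣ, ⨆ t, ∑ i, ((σ i : ℤ) : ℝ) * ψ k i t ≤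
      (b + C₂) * C₄ * (M * ((2 * L * C₁ * C₃ + |ρ 0|) * √n)) := fun k => by
    have h3 := expect_iSup_contraction (fun i t => (b + C₂) * network ρ (W t) (V t) (x i) k)
      (ψ k) (hψl k) (fun _ => 0)
    simp only [zero_add] at h3
    refine h3.trans ?_
    -- ℓ¹–ℓ^∞ duality in the output weights: the supremum over networks splits into one supremum per
    -- hidden unit.
    have h4 : ∀ σ : Fin n → ℤˣ,
        ⨆ t, ∑ i, ((σ i : ℤ) : ℝ) * ((b + C₂) * network ρ (W t) (V t) (x i) k) ≤
        (b + C₂) * C₄ * ∑ m, ⨆ t, |∑ i, ((σ i : ℤ) : ℝ) * ρ (inner ℝ (W t m) (x i))| :=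
      fun σ => ciSup_le fun t => by
        have e : ∑ i, ((σ i : ℤ) : ℝ) * ((b + C₂) * network ρ (W t) (V t) (x i) k) =
            (b + C₂) * ∑ m, V t k m * ∑ i, ((σ i : ℤ) : ℝ) * ρ (inner ℝ (W t m) (x i)) := by
          simp only [network, hiddenFeature, mul_sum]
          rw [sum_comm]
          exact sum_congr rfl fun m _ => sum_congr rfl fun i _ => by ring
        rw [e, mul_assoc, mul_sum univ _ C₄]
        refine mul_le_mul_of_nonneg_left (sum_le_sum fun m _ => ?_) hB
        refine (le_abs_self _).trans ?_
        rw [abs_mul]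
        exact mul_le_mul (hV t k m) (le_iSup_of_finite
          (fun t => |∑ i, ((σ i : ℤ) : ℝ) * ρ (inner ℝ (W t m) (x i))|) t) (abs_nonneg _) hC₄
    refine (expect_le_expect fun σ _ => h4 σ).trans ?_
    rw [← mul_expect, expect_sum_comm]
    refine mul_le_mul_of_nonneg_left ?_ (mul_nonneg hB hC₄)
    refine (sum_le_sum fun m _ =>
      expect_iSup_abs_ridge_le x (fun t => W t m) ρ L hρ hC₁ hx fun t => hW t m).trans ?_
    simp
  refine (sum_le_sum fun k _ => h2 k).trans ?_
  simp

lemma continuous_squaredLoss_network {p M D : ℕ} {ρ : ℝ → ℝ} (hρ : Continuous ρ)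
    (z : EuclideanSpace ℝ (Fin p) × EuclideanSpace ℝ (Fin D)) :
    Continuous fun θ : (Fin M → EuclideanSpace ℝ (Fin p)) × (Fin D → Fin M → ℝ) =>
      squaredLoss (network ρ θ.1 θ.2 z.1) z.2 := by
  unfold squaredLoss network hiddenFeature
  fun_prop

end Network

/-! ### The excess risk bound. -/

lemma exists_measurable_retraction {Z : Type*} [MeasurableSpace Z] {A : Set Z}
    (hA : MeasurableSet A) (hne : A.Nonempty) :
    ∃ r : Z → Z, Measurable r ∧ (∀ z, r z ∈ A) ∧ ∀ z ∈ A, r z = z := by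
  classical
  obtain ⟨a, ha⟩ := hne
  refine ⟨fun z => if z ∈ A then z else a, Measurable.ite hA measurable_id measurable_const,
    fun z => ?_, fun z hz => if_pos hz⟩
  by_cases h : z ∈ A <;> simp [h, ha]

lemma measurable_squaredLoss_network {p M D : ℕ} {ρ : ℝ → ℝ} (hρ : Continuous ρ)
    (W : Fin M → EuclideanSpace ℝ (Fin p)) (V : Fin D → Fin M → ℝ) :
    Measurable fun z : EuclideanSpace ℝ (Fin p) × EuclideanSpace ℝ (Fin D) =>
      squaredLoss (network ρ W V z.1) z.2 := by
  refine Continuous.measurable ?_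
  unfold squaredLoss network hiddenFeature
  fun_prop

theorem mainTheorem5 {p M D N : ℕ} (hM : 2 ≤ M) (hN : 1 ≤ N)
    (ρ : ℝ → ℝ) (Lρ : NNReal) (hρ_nonneg : ∀ t, 0 ≤ ρ t) (hρ_lip : LipschitzWith Lρ ρ)
    (C₁ C₂ C₃ C₄ dmin : ℝ)
    (X : Set (EuclideanSpace ℝ (Fin p))) (hX : ∀ x ∈ X, ‖x‖ ≤ C₁)
    (Q : Measure (EuclideanSpace ℝ (Fin p) × EuclideanSpace ℝ (Fin D))) [IsProbabilityMeasure Q]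
    (hQX : ∀ᵐ z ∂Q, z.1 ∈ X) (hQY : ∀ᵐ z ∂Q, ∀ k, |z.2 k| ≤ C₂)
    (fstar : EuclideanSpace ℝ (Fin p) → EuclideanSpace ℝ (Fin D))
    (hfstar : IsRiskMinimizer (hypothesisClass M D ρ X C₃ C₄ dmin) (expectedRisk Q) fstar)
    (δ : ℝ) (hδ0 : 0 < δ) (hδ1 : δ < 1) :
    ∃ E : Set (Fin N → EuclideanSpace ℝ (Fin p) × EuclideanSpace ℝ (Fin D)),
      MeasurableSet E ∧
      ENNReal.ofReal (1 - δ) ≤ Measure.pi (fun _ : Fin N => Q) E ∧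
      ∀ S ∈ E, ∀ fhat,
        IsRiskMinimizer (hypothesisClass M D ρ X C₃ C₄ dmin) (empiricalRisk S) fhat →
        expectedRisk Q fhat - expectedRisk Q fstar ≤
          (Real.sqrt (constJ M ρ Lρ C₁ C₃ C₄ dmin) + C₂) *
              (constA M D ρ Lρ C₁ C₃ C₄ / Real.sqrt N) +
            (D : ℝ) / 2 * (Real.sqrt (constJ M ρ Lρ C₁ C₃ C₄ dmin) + C₂) ^ 2 *
              Real.sqrt (2 * Real.log (2 / δ) / N) := by
  obtain ⟨⟨Wstar, Vstar, hWs, hVs, hds, rfl⟩, -⟩ := hfstar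
  obtain ⟨Z₀, hZ₀, hZ₀m, hZ₀p⟩ := (hQX.and hQY).exists_measurable_mem
  have hne : Q Z₀ ≠ 0 := by
    rw [(prob_compl_eq_zero_iff hZ₀m).1 hZ₀]
    exact one_ne_zero
  obtain ⟨z₀, hz₀⟩ := nonempty_of_measure_ne_zero hne
  have hC₁ : 0 ≤ C₁ := (norm_nonneg _).trans (hX _ (hZ₀p z₀ hz₀).1)
  -- Without outputs the sign of C₂ is unknown, but both sides vanish.
  rcases Nat.eq_zero_or_pos D with rfl | hD
  · refine ⟨Set.univ, MeasurableSet.univ, ?_, fun S _ fhat _ => ?_⟩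
    · rw [measure_univ, ← ENNReal.ofReal_one]
      exact ENNReal.ofReal_le_ofReal (by linarith)
    · simp [expectedRisk, squaredLoss_eq_sum, constA]
  have hC₂ : 0 ≤ C₂ := (abs_nonneg _).trans ((hZ₀p z₀ hz₀).2 ⟨0, hD⟩)
  have hC₃ : 0 ≤ C₃ := (norm_nonneg _).trans (hWs ⟨0, by omega⟩)
  have hC₄ : 0 ≤ C₄ := (abs_nonneg _).trans (hVs ⟨0, hD⟩ ⟨0, by omega⟩)
  set b := Real.sqrt (constJ M ρ Lρ C₁ C₃ C₄ dmin)
  have hB : 0 ≤ b + C₂ := add_nonneg (Real.sqrt_nonneg _) hC₂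
  let K : Set ((Fin M → EuclideanSpace ℝ (Fin p)) × (Fin D → Fin M → ℝ)) :=
    {θ | (∀ m, ‖θ.1 m‖ ≤ C₃) ∧ (∀ k m, |θ.2 k m| ≤ C₄) ∧
      ∀ x ∈ X, dmin ^ 2 ≤ featureDiversity ρ θ.1 x}
  have hnet : ∀ θ ∈ K, ∀ x ∈ X, ∀ k, |network ρ θ.1 θ.2 x k| ≤ b := fun θ hθ x hx k =>
    abs_network_le hM hρ_nonneg hρ_lip hθ.1 hθ.2.1 (hX x hx) (hθ.2.2 x hx) k
  let θs : K := ⟨(Wstar, Vstar), hWs, hVs, hds⟩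
  have : Nonempty K := ⟨θs⟩
  -- The data bounds hold only on the full-measure set Z₀. Precomposing with a retraction onto Z₀
  -- makes them hold everywhere without changing any expected risk.
  obtain ⟨r, hr, hrZ, hrid⟩ := exists_measurable_retraction hZ₀m ⟨z₀, hz₀⟩
  let ℓ : K → EuclideanSpace ℝ (Fin p) × EuclideanSpace ℝ (Fin D) → ℝ := fun θ z =>
    squaredLoss (network ρ θ.1.1 θ.1.2 (r z).1) (r z).2
  have hℓm : ∀ θ, Measurable (ℓ θ) := fun θ =>
    (measurable_squaredLoss_network hρ_lip.continuous θ.1.1 θ.1.2).comp hr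
  have hℓc : ∀ z, Continuous fun θ => ℓ θ z := fun z =>
    (continuous_squaredLoss_network hρ_lip.continuous (r z)).comp continuous_subtype_val
  have hℓ0 : ∀ θ z, 0 ≤ ℓ θ z := fun θ z => squaredLoss_nonneg _ _
  have hℓ1 : ∀ θ z, ℓ θ z ≤ D / 2 * (b + C₂) ^ 2 := fun θ z =>
    squaredLoss_le (hnet θ.1 θ.2 _ (hZ₀p _ (hrZ z)).1) (hZ₀p _ (hrZ z)).2
  have hℓi : ∀ θ, Integrable (ℓ θ) Q := fun θ =>
    integrable_of_measurable_of_abs_le (hℓm θ) fun z => by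
      rw [abs_of_nonneg (hℓ0 θ z)]; exact hℓ1 θ z
  have hrisk : ∀ θ : K, expectedRisk Q (network ρ θ.1.1 θ.1.2) = ∫ z, ℓ θ z ∂Q := fun θ => by
    refine integral_congr_ae ?_
    filter_upwards [hZ₀] with z hz
    simp only [ℓ, hrid z hz]
  have hA : 0 ≤ constA M D ρ Lρ C₁ C₃ C₄ := by
    unfold constA
    positivity
  -- If b + C₂ = 0, every expected risk in the class is zero; otherwise c > 0, which the tail
  -- exponent requires.
  rcases hB.eq_or_lt with hB0 | hBpos
  · refine ⟨Set.univ, MeasurableSet.univ, ?_, fun S _ fhat hfhat => ?_⟩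
    · rw [measure_univ, ← ENNReal.ofReal_one]
      exact ENNReal.ofReal_le_ofReal (by linarith)
    · obtain ⟨⟨W, V, hW, hV, hd, rfl⟩, -⟩ := hfhat
      have h0 : ∀ θ : K, expectedRisk Q (network ρ θ.1.1 θ.1.2) = 0 := fun θ => by
        have : ∀ z, ℓ θ z = 0 := fun z => by
          have h1 := hℓ1 θ z
          rw [← hB0] at h1
          exact le_antisymm (by simpa using h1) (hℓ0 θ z)
        rw [hrisk]
        simp [this]
      have h1 := h0 ⟨(W, V), hW, hV, hd⟩
      have h2 := h0 θs
      dsimp only [θs] at h1 h2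
      rw [h1, h2, ← hB0]
      simp
  set c := (D : ℝ) / 2 * (b + C₂) ^ 2
  have hD' : (0 : ℝ) < D := by exact_mod_cast hD
  have hN' : (0 : ℝ) < N := by exact_mod_cast hN
  have hcpos : 0 < c := by positivity
  have hlog : 0 < Real.log (2 / δ) := Real.log_pos (by rw [lt_div_iff₀ hδ0]; linarith)
  obtain ⟨E, hEm, hEμ, hE⟩ := exists_measurableSet_uniform_deviation Q (n := N)
    (G := fun θ z => ℓ θ z - ℓ θs z) (fun θ => (hℓm θ).sub (hℓm θs))
    (fun z => (hℓc z).sub continuous_const) (c := c)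
    (fun θ z => abs_sub_le_iff.2
      ⟨by linarith [hℓ1 θ z, hℓ0 θs z], by linarith [hℓ1 θs z, hℓ0 θ z]⟩)
    (fun m s S => expect_iSup_excess_squaredLoss_le hρ_lip hC₁ hC₄ hB
      (fun t => (s t).1.1) (fun t => (s t).1.2) (fun t => (s t).2.1) (fun t => (s t).2.2.1)
      (fun i => (r (S i)).1) (fun i => (r (S i)).2)
      (fun i => network ρ Wstar Vstar (r (S i)).1) (fun i => hX _ (hZ₀p _ (hrZ _)).1)
      (fun i => (hZ₀p _ (hrZ _)).2) (fun t i => hnet _ (s t).2 _ (hZ₀p _ (hrZ _)).1))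
    -- This ε makes the tail bound equal to δ/2, which is below the required δ.
    (ε := c * √(2 * N * Real.log (2 / δ))) (η := δ) (by positivity) (by
      rw [mul_pow, Real.sq_sqrt (by positivity)]
      have e : c ^ 2 * (2 * N * Real.log (2 / δ)) / (2 * N * c ^ 2) = Real.log (2 / δ) := by
        field_simp
      rw [e, Real.exp_neg, Real.exp_log (by positivity), inv_div]
      linarith)
  refine ⟨E ∩ Set.univ.pi fun _ => Z₀, hEm.inter (MeasurableSet.univ_pi fun _ => hZ₀m), ?_,
    fun S hS fhat hfhat => ?_⟩
  · rw [measure_inter_conull]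
    · exact hEμ
    · rw [prob_compl_eq_zero_iff (MeasurableSet.univ_pi fun _ => hZ₀m), Measure.pi_pi,
        (prob_compl_eq_zero_iff hZ₀m).1 hZ₀]
      simp
  · obtain ⟨⟨W, V, hW, hV, hd, rfl⟩, hmin⟩ := hfhat
    set θ : K := ⟨(W, V), hW, hV, hd⟩
    have h1 := hE S hS.1 θ
    have h2 := hmin (network ρ Wstar Vstar) ⟨Wstar, Vstar, hWs, hVs, hds, rfl⟩
    have hemp : ∀ θ : K, empiricalRisk S (network ρ θ.1.1 θ.1.2) = 1 / N * ∑ i, ℓ θ (S i) :=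
      fun θ => by
        simp only [empiricalRisk, ℓ, hrid _ (hS.2 _ (Set.mem_univ _))]
    have h3 := (hemp θ).symm.le.trans (h2.trans (hemp θs).le)
    replace h3 := le_of_mul_le_mul_left h3 (by positivity)
    rw [Finset.sum_sub_distrib, Finset.sum_sub_distrib, Finset.sum_const,
      integral_sub (hℓi θ) (hℓi θs), ← hrisk θ, ← hrisk θs, Finset.card_univ, Fintype.card_fin,
      nsmul_eq_mul] at h1
    change expectedRisk Q (network ρ θ.1.1 θ.1.2) - expectedRisk Q (network ρ θs.1.1 θs.1.2) ≤ _
    have e1 : √(2 * N * Real.log (2 / δ)) = N * √(2 * Real.log (2 / δ) / N) := by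
      rw [← Real.sqrt_sq hN'.le, ← Real.sqrt_mul (sq_nonneg _), Real.sqrt_sq hN'.le]
      congr 1
      field_simp
    have e2 : (N : ℝ) * ((b + C₂) * (constA M D ρ Lρ C₁ C₃ C₄ / √N)) =
        (b + C₂) * constA M D ρ Lρ C₁ C₃ C₄ * √N := by
      rw [show (N : ℝ) * ((b + C₂) * (constA M D ρ Lρ C₁ C₃ C₄ / √N)) =
        (b + C₂) * constA M D ρ Lρ C₁ C₃ C₄ * (N / √N) by ring, Real.div_sqrt]
    -- Twice the Rademacher bound is only half of N times the first term of the claim; the other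
    -- half is slack.
    have e3 : 2 * (D * ((b + C₂) * C₄ * (M * ((2 * Lρ * C₁ * C₃ + |ρ 0|) * √N)))) =
        (b + C₂) * constA M D ρ Lρ C₁ C₃ C₄ * √N / 2 := by
      unfold constA
      ring
    have h4 : 0 ≤ (b + C₂) * constA M D ρ Lρ C₁ C₃ C₄ * √N := by positivity
    rw [e1, e3] at h1
    refine le_of_mul_le_mul_left ?_ hN'
    rw [mul_add, e2]
    have e4 : (N : ℝ) * (c * √(2 * Real.log (2 / δ) / N)) =
        c * (N * √(2 * Real.log (2 / δ) / N)) := by ring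
    rw [e4]
    linarith
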